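/- Let $0<\gamma<t$, put $q=e^{-2(t-\gamma)}\in(0,1)$, and let $s\in\{2\gamma,0\}$. Consider the systems of monic real polynomials $(P_k^{\rm DW})_{k\ge 0}$, $(P_k^{\rm HT})_{k\ge 0}$, with $\deg P_k^{\rm DW}=\deg P_k^{\rm HT}=k$, and the constants $h_k^{\rm DW}$, $h_k^{\rm HT}$, given by the discrete orthogonality relations on the positive integers $$\sum_{\ell=1}^\infty P_j^{\rm DW}(\ell)P_k^{\rm DW}(\ell)\left[e^{-2\ell(t-\gamma)}-e^{-2\ell(t+\gamma)}\right]=h_k^{\rm DW}\delta_{jk},$$ $$\sum_{\ell=1}^\infty P_j^{\rm HT}(\ell)P_k^{\rm HT}(\ell)\left[e^{-2\ell(t-\gamma)}+e^{-2\ell(t+\gamma)-s}\right]=h_k^{\rm HT}\delta_{jk}.$$ Let $$h_k^{\rm Q}=\frac{(k!)^2q^{k+1}}{(1-q)^{2k+1}}.$$ Then both systems exist; there are monic polynomials $P_k^{\rm Q}$ of degree $k$ (shifted Meixner polynomials) with $\sum_{\ell=1}^\infty P_j^{\rm Q}(\ell)P_k^{\rm Q}(\ell)q^\ell=h_k^{\rm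 Q}\delta_{jk}$; and for every $\varepsilon>0$, as $k\to\infty$, $$h_k^{\rm DW}=h_k^{\rm HT}\left(1+\mathcal O\left(e^{-k^{1-\varepsilon}}\right)\right),\qquad h_k^{\rm DW}=h_k^{\rm Q}\left(1+\mathcal O\left(e^{-k^{1-\varepsilon}}\right)\right),\qquad h_k^{\rm HT}=h_k^{\rm Q}\left(1+\mathcal O\left(e^{-k^{1-\varepsilon}}\right)\right),$$ where the implied constants may depend on $t,\gamma,\varepsilon$. -/

import Mathlib

/-- `P` is the system of monic orthogonal polynomials (`P k` of degree exactly `k`) for the discrete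
weight `w` on the lattice `{1, 2, 3, …}`, and `h k` is the squared norm of `P k`:
`∑_{ℓ ≥ 1} P_j(ℓ) P_k(ℓ) w(ℓ) = h_k δ_{jk}`, the series being convergent.
The summation index below is `ℓ - 1 ∈ {0, 1, 2, …}`. -/
structure IsMonicOrthogonal (w : ℕ → ℝ) (P : ℕ → Polynomial ℝ) (h : ℕ → ℝ) : Prop where
  monic : ∀ k, (P k).Monic
  natDegree_eq : ∀ k, (P k).natDegree = k
  orthogonal : ∀ j k : ℕ,
    HasSum
      (fun i : ℕ =>
        (P j).eval ((i + 1 : ℕ) : ℝ) * (P k).eval ((i + 1 : ℕ) : ℝ) * w (i + 1))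
      (if j = k then h k else 0)

/-- The weight of the domain wall system in the ferroelectric phase. -/
noncomputable def weightDW (t γ : ℝ) (l : ℕ) : ℝ :=
  Real.exp (-2 * (l : ℝ) * (t - γ)) - Real.exp (-2 * (l : ℝ) * (t + γ))

/-- The weight `e^{-2l(t-γ)} + e^{-2l(t+γ)-s}` of the half-turn system in the ferroelectric phase;
it is used with `s = 2γ` and with `s = 0`. -/
noncomputable def weightHT (t γ s : ℝ) (l : ℕ) : ℝ :=
  Real.exp (-2 * (l : ℝ) * (t - γ)) + Real.exp (-2 * (l : ℝ) * (t + γ) - s)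

/-- The Meixner norm `h_k^Q = (k!)² q^{k+1} / (1 - q)^{2k+1}`. -/
noncomputable def meixnerNorm (q : ℝ) (k : ℕ) : ℝ :=
  (k.factorial : ℝ) ^ 2 * q ^ (k + 1) / (1 - q) ^ (2 * k + 1)

/-- `a k = b k (1 + O(e^{-k^{1-ε}}))` as `k → ∞`. -/
def EqUpToRelError (ε : ℝ) (a b : ℕ → ℝ) : Prop :=
  ∃ u : ℕ → ℝ,
    Asymptotics.IsBigO Filter.atTop u (fun k : ℕ => Real.exp (-((k : ℝ) ^ (1 - ε)))) ∧
      ∀ k, a k = b k * (1 + u k)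

/-!
For a positive weight `w` on `{1, 2, 3, …}` the norm `h_k` is the minimum of `∑ Q(l)² w(l)` over
monic `Q` of degree `k`. The domain wall and half-turn weights are perturbations of the Meixner
weight `v(l) = q ^ l` by a multiple of `e(l) = r ^ l`, where `r = e^{-2(t+γ)} < q`; precisely
`w ≤ v + C e` and `v² / w ≤ v + C e` on `l ≥ 1`, with `C = 1 / (1 - r / q)`. Testing the minimum
property with the Meixner polynomial `Q_k` bounds `h_k` from above, and a Cauchy–Schwarz argument
with the pairing `∑ Q_k P_k v = h_k^Q` bounds it from below, so that
`|h_k - h_k^Q| ≤ C ∑ Q_k(l)² r ^ l` (`IsMonicOrthogonal.abs_norm_sub_le`).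

The right-hand side is exponentially small relative to `h_k^Q`
(`exists_momentFunctional_meixnerPoly_le`). Up to normalisation `Q_k(x + 1)` is
`M_k(x) = ∑_j C(k, j) C(x, j) (-a)^j` with `a = (1 - q) / q`, which is symmetric in `k` and `x`.
The symmetry turns the orthogonality relation into the pointwise bound
`q ^ k M_k(x)² ≤ q ^ (-x) / (1 - q)`, which is good for large `x`
(`pow_mul_meixnerValue_sq_le`), while the explicit sum gives
`|M_k(x)| ≤ (1 + b) ^ k (1 + a / b) ^ x` for every `b > 0`, which with `q (1 + b)² < 1` is good for
small `x` (`abs_meixnerValue_le`). Interpolating between the two gives geometric decay of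
`q ^ k M_k(x)² r ^ x` in `k` and `x` jointly.

Orthogonality of the Meixner polynomials (`isMonicOrthogonal_meixnerPoly`) is tested against the
rising factorials `l (l + 1) ⋯ (l + i - 1)`: the pairing is a negative binomial series which
reduces to a `k`-th finite difference of a polynomial of degree `i ≤ k`. For the other two weights
orthogonal polynomials exist because the moment functional is positive definite
(`exists_isMonicOrthogonal`).
-/

open Polynomial Finset

/-! ### The moment functional of a discrete weight -/

/-- The series `∑_{l ≥ 1} p(l) w(l)` converges for every polynomial `p`. -/
def HasMoments (w : ℕ → ℝ) : Prop :=
  ∀ p : ℝ[X], Summable fun i : ℕ => p.eval ((i + 1 : ℕ) : ℝ) * w (i + 1)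

/-- The linear functional `p ↦ ∑_{l ≥ 1} p(l) w(l)`. -/
noncomputable def momentFunctional (w : ℕ → ℝ) (hw : HasMoments w) : ℝ[X] →ₗ[ℝ] ℝ where
  toFun p := ∑' i : ℕ, p.eval ((i + 1 : ℕ) : ℝ) * w (i + 1)
  map_add' p q := by
    rw [← (hw p).tsum_add (hw q)]
    simp only [eval_add, add_mul]
  map_smul' c p := by
    simp only [eval_smul, smul_eq_mul, mul_assoc, RingHom.id_apply, tsum_mul_left]

lemma hasSum_momentFunctional {w : ℕ → ℝ} (hw : HasMoments w) (p : ℝ[X]) :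
    HasSum (fun i : ℕ => p.eval ((i + 1 : ℕ) : ℝ) * w (i + 1)) (momentFunctional w hw p) :=
  (hw p).hasSum

lemma HasMoments.add {v w : ℕ → ℝ} (hv : HasMoments v) (hw : HasMoments w) :
    HasMoments (fun l => v l + w l) := fun p => by
  simpa only [mul_add] using (hv p).add (hw p)

lemma HasMoments.const_mul {w : ℕ → ℝ} (c : ℝ) (hw : HasMoments w) :
    HasMoments (fun l => c * w l) := fun p => by
  simpa only [mul_left_comm c] using (hw p).mul_left c

lemma hasMoments_geometric {r : ℝ} (h0 : 0 ≤ r) (h1 : r < 1) : HasMoments (fun l => r ^ l) := by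
  intro p
  have key : Summable fun n : ℕ => p.eval (n : ℝ) * r ^ n := by
    simp only [eval_eq_sum_range, sum_mul]
    refine summable_sum fun j _ => ?_
    simp only [mul_assoc]
    exact (summable_pow_mul_geometric_of_norm_lt_one (R := ℝ) j
      (by rwa [Real.norm_of_nonneg h0])).mul_left _
  exact (summable_nat_add_iff 1).2 key

lemma momentFunctional_mul_self_nonneg {w : ℕ → ℝ} (hw : HasMoments w)
    (hpos : ∀ l, 1 ≤ l → 0 < w l) (p : ℝ[X]) : 0 ≤ momentFunctional w hw (p * p) :=
  (hasSum_momentFunctional hw (p * p)).nonneg fun i => by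
    rw [eval_mul]
    exact mul_nonneg (mul_self_nonneg _) (hpos _ (by omega)).le

lemma momentFunctional_mul_self_pos {w : ℕ → ℝ} (hw : HasMoments w)
    (hpos : ∀ l, 1 ≤ l → 0 < w l) {p : ℝ[X]} (hp : p ≠ 0) :
    0 < momentFunctional w hw (p * p) := by
  obtain ⟨i, hi⟩ : ∃ i : ℕ, p.eval ((i + 1 : ℕ) : ℝ) ≠ 0 := by
    by_contra! hcon
    refine hp (eq_zero_of_infinite_isRoot p ((Set.infinite_range_of_injective
      (f := fun i : ℕ => ((i + 1 : ℕ) : ℝ)) fun a b hab => ?_).mono ?_))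
    · simpa using hab
    · rintro _ ⟨i, rfl⟩
      exact hcon i
  have hterm : ∀ i : ℕ, 0 ≤ (p * p).eval ((i + 1 : ℕ) : ℝ) * w (i + 1) := fun i => by
    rw [eval_mul]
    exact mul_nonneg (mul_self_nonneg _) (hpos _ (by omega)).le
  refine (hw (p * p)).tsum_pos hterm i ?_
  rw [eval_mul]
  exact mul_pos (mul_self_pos.2 hi) (hpos _ (by omega))

/-! ### Orthogonality to lower degrees -/

lemma Polynomial.Monic.degree_sub_lt_of_natDegree_eq {p B : ℝ[X]} {k : ℕ} (hp : p.Monic)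
    (hpk : p.natDegree = k) (hB : B.Monic) (hBk : B.natDegree = k) : (p - B).degree < k := by
  have := degree_sub_lt_left (p := p) (q := B)
    (by rw [degree_eq_natDegree hp.ne_zero, degree_eq_natDegree hB.ne_zero, hpk, hBk])
    hp.ne_zero (by rw [hp.leadingCoeff, hB.leadingCoeff])
  rwa [degree_eq_natDegree hp.ne_zero, hpk] at this

lemma linearMap_eq_zero_of_degree_lt (f : ℝ[X] →ₗ[ℝ] ℝ) {B : ℕ → ℝ[X]} (hB : ∀ i, (B i).Monic)
    (hd : ∀ i, (B i).natDegree = i) (k : ℕ) (h : ∀ i < k, f (B i) = 0) (p : ℝ[X])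
    (hp : p.degree < k) : f p = 0 := by
  induction k generalizing p with
  | zero =>
    have : p = 0 := by
      rw [← degree_eq_bot]
      simpa using hp
    rw [this, map_zero]
  | succ k ih =>
    have hlt : (p - C (p.coeff k) * B k).degree < k := by
      rw [degree_lt_iff_coeff_zero] at hp ⊢
      intro m hm
      rw [coeff_sub, coeff_C_mul]
      rcases hm.eq_or_lt with rfl | hm
      · have := (hB k).coeff_natDegree
        rw [hd] at this
        rw [this, mul_one, sub_self]
      · rw [hp m hm, coeff_eq_zero_of_natDegree_lt (p := B k) (by rw [hd]; exact hm), mul_zero,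
          sub_zero]
    have h1 := ih (fun i hi => h i (by omega)) _ hlt
    rwa [map_sub, ← smul_eq_C_mul, map_smul, h k (by omega), smul_zero, sub_zero] at h1

/-- A functional that annihilates all degrees below `k` takes one common value on the monic
polynomials of degree `k`. -/
lemma linearMap_eq_of_monic (f : ℝ[X] →ₗ[ℝ] ℝ) {k : ℕ}
    (h : ∀ p : ℝ[X], p.degree < k → f p = 0) {p B : ℝ[X]} (hp : p.Monic) (hpk : p.natDegree = k)
    (hB : B.Monic) (hBk : B.natDegree = k) : f p = f B := by
  have := h _ (hp.degree_sub_lt_of_natDegree_eq hpk hB hBk)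
  rwa [map_sub, sub_eq_zero] at this

lemma isMonicOrthogonal_of_degree_lt {w : ℕ → ℝ} (hw : HasMoments w) {P : ℕ → ℝ[X]} {h : ℕ → ℝ}
    (hm : ∀ k, (P k).Monic) (hd : ∀ k, (P k).natDegree = k)
    (h0 : ∀ k : ℕ, ∀ p : ℝ[X], p.degree < k → momentFunctional w hw (P k * p) = 0)
    (hh : ∀ k, momentFunctional w hw (P k * P k) = h k) : IsMonicOrthogonal w P h where
  monic := hm
  natDegree_eq := hd
  orthogonal j k := by
    have key : momentFunctional w hw (P j * P k) = if j = k then h k else 0 := by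
      have hdeg : ∀ i, (P i).degree = i := fun i => by
        rw [degree_eq_natDegree (hm i).ne_zero, hd]
      split_ifs with hjk
      · rw [hjk, hh]
      · rcases Nat.lt_or_gt_of_ne hjk with hlt | hlt
        · rw [mul_comm]
          exact h0 k _ (by rw [hdeg]; exact_mod_cast hlt)
        · exact h0 j _ (by rw [hdeg]; exact_mod_cast hlt)
    have := hasSum_momentFunctional hw (P j * P k)
    rw [key] at this
    simpa only [eval_mul] using this

lemma IsMonicOrthogonal.momentFunctional_mul {w : ℕ → ℝ} (hw : HasMoments w) {P : ℕ → ℝ[X]}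
    {h : ℕ → ℝ} (H : IsMonicOrthogonal w P h) {k : ℕ} {p : ℝ[X]} (hp : p.Monic)
    (hpk : p.natDegree = k) : momentFunctional w hw (P k * p) = h k := by
  have horth : ∀ j, momentFunctional w hw (P k * P j) = if k = j then h j else 0 := fun j =>
    (hasSum_momentFunctional hw _).unique (by simpa only [eval_mul] using H.orthogonal k j)
  let f : ℝ[X] →ₗ[ℝ] ℝ := momentFunctional w hw ∘ₗ LinearMap.mulLeft ℝ (P k)
  have hf : ∀ p : ℝ[X], p.degree < k → f p = 0 :=
    linearMap_eq_zero_of_degree_lt f H.monic H.natDegree_eq k fun i hi => by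
      simp [f, horth, hi.ne']
  have := linearMap_eq_of_monic f hf hp hpk (H.monic k) (H.natDegree_eq k)
  simpa [f, horth] using this

/-- Positive weights with finite moments have monic orthogonal polynomials: `q ↦ L(q · )` is an
injective, hence surjective, map from the polynomials of degree less than `k` to their dual, so the
functional `L(X ^ k · )` can be represented by a polynomial of lower degree. -/
lemma exists_isMonicOrthogonal {w : ℕ → ℝ} (hw : HasMoments w) (hpos : ∀ l, 1 ≤ l → 0 < w l) :
    ∃ (P : ℕ → ℝ[X]) (h : ℕ → ℝ), IsMonicOrthogonal w P h := by
  have key : ∀ k : ℕ, ∃ P : ℝ[X], P.Monic ∧ P.natDegree = k ∧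
      ∀ p : ℝ[X], p.degree < k → momentFunctional w hw (P * p) = 0 := by
    intro k
    let T : degreeLT ℝ k →ₗ[ℝ] Module.Dual ℝ (degreeLT ℝ k) :=
      (((LinearMap.mul ℝ ℝ[X]).compr₂ (momentFunctional w hw)).domRestrict₁₂
        (degreeLT ℝ k) (degreeLT ℝ k))
    have hT : ∀ a b : degreeLT ℝ k, T a b = momentFunctional w hw (a.1 * b.1) := fun a b => rfl
    have : FiniteDimensional ℝ (degreeLT ℝ k) := (degreeLTEquiv ℝ k).symm.finiteDimensional
    have hinj : Function.Injective T := by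
      rw [injective_iff_map_eq_zero]
      intro a ha
      by_contra hne
      have h1 : 0 < momentFunctional w hw (a.1 * a.1) :=
        momentFunctional_mul_self_pos hw hpos fun h => hne (Subtype.ext h)
      rw [← hT, ha] at h1
      exact lt_irrefl _ h1
    have hsurj : Function.Surjective T :=
      (LinearMap.injective_iff_surjective_of_finrank_eq_finrank
        (Subspace.dual_finrank_eq (K := ℝ) (V := degreeLT ℝ k)).symm).1 hinj
    obtain ⟨c, hc⟩ := hsurj
      ((momentFunctional w hw ∘ₗ LinearMap.mulLeft ℝ (X ^ k)) ∘ₗ (degreeLT ℝ k).subtype)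
    have hcd : c.1.degree < k := mem_degreeLT.1 c.2
    have hmon : (X ^ k - c.1).Monic := monic_X_pow_sub hcd
    refine ⟨X ^ k - c.1, hmon, ?_, fun p hp => ?_⟩
    · refine natDegree_eq_of_degree_eq_some ?_
      rw [degree_sub_eq_left_of_degree_lt (by rwa [degree_X_pow]), degree_X_pow]
    · have h1 := LinearMap.congr_fun hc ⟨p, mem_degreeLT.2 hp⟩
      rw [hT] at h1
      simp only [LinearMap.comp_apply, Submodule.subtype_apply, LinearMap.mulLeft_apply] at h1
      rw [sub_mul, map_sub, h1, sub_self]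
  choose P hm hd h0 using key
  exact ⟨P, fun k => momentFunctional w hw (P k * P k),
    isMonicOrthogonal_of_degree_lt hw hm hd h0 fun _ => rfl⟩

/-! ### Comparison of norms -/

lemma IsMonicOrthogonal.norm_pos {w : ℕ → ℝ} (hw : HasMoments w) (hpos : ∀ l, 1 ≤ l → 0 < w l)
    {P : ℕ → ℝ[X]} {h : ℕ → ℝ} (H : IsMonicOrthogonal w P h) (k : ℕ) : 0 < h k := by
  rw [← H.momentFunctional_mul hw (H.monic k) (H.natDegree_eq k)]
  exact momentFunctional_mul_self_pos hw hpos (H.monic k).ne_zero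

/-- `h k` is the minimum of `∑ Q(l)² w(l)` over monic `Q` of degree `k`. -/
lemma IsMonicOrthogonal.norm_le {w : ℕ → ℝ} (hw : HasMoments w) (hpos : ∀ l, 1 ≤ l → 0 < w l)
    {P : ℕ → ℝ[X]} {h : ℕ → ℝ} (H : IsMonicOrthogonal w P h) {k : ℕ} {Q : ℝ[X]} (hQ : Q.Monic)
    (hQk : Q.natDegree = k) : h k ≤ momentFunctional w hw (Q * Q) := by
  have h0 := momentFunctional_mul_self_nonneg hw hpos (Q - P k)
  have h1 := H.momentFunctional_mul hw hQ hQk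
  have h2 := H.momentFunctional_mul hw (H.monic k) (H.natDegree_eq k)
  have h3 : (Q - P k) * (Q - P k) = Q * Q - (P k * Q + P k * Q) + P k * P k := by ring
  rw [h3, map_add, map_sub, map_add, h1, h2] at h0
  linarith

/-- If `w` differs from `v` by at most a multiple of `e`, in the sense that `w ≤ v + C e` and
`v² / w ≤ v + C e`, then the norms for `w` and `v` differ by at most the corresponding multiple of
the `e`-norm of the orthogonal polynomial for `v`. The upper bound is the minimum property of
`h k`; the lower bound comes from
`g k = ∑ Q P v` and `2 Q P v ≤ Q² v² / w + P² w`. -/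
lemma IsMonicOrthogonal.abs_norm_sub_le {v w e : ℕ → ℝ} {C : ℝ} (hv : HasMoments v)
    (hw : HasMoments w) (he : HasMoments e) (hvpos : ∀ l, 1 ≤ l → 0 < v l)
    (hwpos : ∀ l, 1 ≤ l → 0 < w l) (hepos : ∀ l, 1 ≤ l → 0 < e l) (hC : 0 ≤ C)
    (h1 : ∀ l, 1 ≤ l → w l ≤ v l + C * e l)
    (h2 : ∀ l, 1 ≤ l → v l ^ 2 ≤ w l * (v l + C * e l))
    {P Q : ℕ → ℝ[X]} {h g : ℕ → ℝ} (HP : IsMonicOrthogonal w P h)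
    (HQ : IsMonicOrthogonal v Q g) (k : ℕ) :
    |h k - g k| ≤ C * momentFunctional e he (Q k * Q k) := by
  set E := momentFunctional e he (Q k * Q k) with hE
  have hE0 : 0 ≤ C * E := mul_nonneg hC (momentFunctional_mul_self_nonneg he hepos _)
  have hg : 0 < g k := HQ.norm_pos hv hvpos k
  have hQQ : momentFunctional v hv (Q k * Q k) = g k :=
    HQ.momentFunctional_mul hv (HQ.monic k) (HQ.natDegree_eq k)
  have hQP : momentFunctional v hv (Q k * P k) = g k :=
    HQ.momentFunctional_mul hv (HP.monic k) (HP.natDegree_eq k)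
  have hPP : momentFunctional w hw (P k * P k) = h k :=
    HP.momentFunctional_mul hw (HP.monic k) (HP.natDegree_eq k)
  have upper : h k ≤ g k + C * E := by
    refine (HP.norm_le hw hwpos (HQ.monic k) (HQ.natDegree_eq k)).trans ?_
    have hs := (hasSum_momentFunctional hv (Q k * Q k)).add
      ((hasSum_momentFunctional he (Q k * Q k)).mul_left C)
    rw [hQQ] at hs
    refine hasSum_le (fun i => ?_) (hasSum_momentFunctional hw (Q k * Q k)) hs
    rw [eval_mul]
    nlinarith [mul_le_mul_of_nonneg_left (h1 (i + 1) (by omega))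
      (mul_self_nonneg ((Q k).eval ((i + 1 : ℕ) : ℝ)))]
  have lower : 2 * g k ≤ g k + C * E + h k := by
    have hs2 := ((hasSum_momentFunctional hv (Q k * Q k)).add
      ((hasSum_momentFunctional he (Q k * Q k)).mul_left C)).add
        (hasSum_momentFunctional hw (P k * P k))
    have hs3 := (hasSum_momentFunctional hv (Q k * P k)).mul_left 2
    rw [hQP] at hs3
    rw [hQQ, hPP] at hs2
    refine hasSum_le (fun i => ?_) hs3 hs2
    rw [eval_mul, eval_mul, eval_mul]
    generalize (Q k).eval ((i + 1 : ℕ) : ℝ) = a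
    generalize (P k).eval ((i + 1 : ℕ) : ℝ) = b
    -- after multiplication by `w` the difference is at least the square `(a v - b w) ^ 2`
    refine le_of_mul_le_mul_left ?_ (hwpos (i + 1) (by omega))
    nlinarith [sq_nonneg (a * v (i + 1) - b * w (i + 1)),
      mul_le_mul_of_nonneg_left (h2 (i + 1) (by omega)) (sq_nonneg a)]
  rw [abs_le]
  constructor <;> linarith

/-! ### Meixner polynomials -/

/-- The value `∑_j C(n, j) C(x, j) (-a)^j = ₂F₁(-n, -x; 1; -a)` at `x ∈ ℕ` of the Meixner polynomial
of degree `n` with `β = 1`. For the weight `q ^ x` on `{0, 1, 2, …}` the parameter is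
`a = (1 - q) / q`. -/
noncomputable def meixnerValue (a : ℝ) (n x : ℕ) : ℝ :=
  ∑ j ∈ range (n + 1), (n.choose j : ℝ) * x.choose j * (-a) ^ j

/-- The monic Meixner polynomial of degree `n` in the variable `l = x + 1`. -/
noncomputable def meixnerPoly (a : ℝ) (n : ℕ) : ℝ[X] :=
  ∑ j ∈ range (n + 1), C ((n.factorial : ℝ) / (-a) ^ n * (n.choose j * (-a) ^ j / j.factorial)) *
    (descPochhammer ℝ j).comp (X - C 1)

/-- The self-duality of the Meixner polynomials with `β = 1`. -/
lemma meixnerValue_comm (a : ℝ) (n x : ℕ) : meixnerValue a n x = meixnerValue a x n := by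
  have key : ∀ n x : ℕ, meixnerValue a n x =
      ∑ j ∈ range (max n x + 1), (n.choose j : ℝ) * x.choose j * (-a) ^ j := fun n x => by
    refine sum_subset (range_mono (by omega)) fun j _ hj => ?_
    rw [Nat.choose_eq_zero_of_lt (by simpa using hj)]
    simp
  rw [key, key x n, max_comm]
  simp only [mul_comm]

lemma meixnerPoly_eval (a : ℝ) (n x : ℕ) :
    (meixnerPoly a n).eval ((x + 1 : ℕ) : ℝ) = n.factorial / (-a) ^ n * meixnerValue a n x := by
  simp only [meixnerPoly, meixnerValue, eval_finsetSum, mul_sum]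
  refine sum_congr rfl fun j _ => ?_
  have : (descPochhammer ℝ j).eval (x : ℝ) = j.factorial * x.choose j := by
    rw [descPochhammer_eval_eq_descFactorial, Nat.descFactorial_eq_factorial_mul_choose,
      Nat.cast_mul]
  have hj : (j.factorial : ℝ) ≠ 0 := by positivity
  simp only [eval_mul, eval_C, eval_comp, eval_sub, eval_X, Nat.cast_add, Nat.cast_one,
    add_sub_cancel_right, this]
  field_simp

lemma meixnerPoly_monic_natDegree {a : ℝ} (ha : a ≠ 0) (n : ℕ) :
    (meixnerPoly a n).Monic ∧ (meixnerPoly a n).natDegree = n := by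
  have hm : ∀ j, ((descPochhammer ℝ j).comp (X - C 1)).Monic := fun j =>
    (monic_descPochhammer ℝ j).comp (monic_X_sub_C 1) (by rw [natDegree_X_sub_C]; exact one_ne_zero)
  have hd : ∀ j, ((descPochhammer ℝ j).comp (X - C 1)).natDegree = j := fun j => by
    rw [natDegree_comp, descPochhammer_natDegree, natDegree_X_sub_C, mul_one]
  have hdeg : ((descPochhammer ℝ n).comp (X - C 1)).degree = n := by
    rw [degree_eq_natDegree (hm n).ne_zero, hd]
  have hlast : (n.factorial : ℝ) / (-a) ^ n * (n.choose n * (-a) ^ n / n.factorial) = 1 := by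
    have : (-a) ^ n ≠ 0 := pow_ne_zero _ (neg_ne_zero.2 ha)
    have : (n.factorial : ℝ) ≠ 0 := by positivity
    rw [Nat.choose_self]
    field_simp
    simp
  rw [meixnerPoly, sum_range_succ, hlast, ← smul_eq_C_mul (1 : ℝ), one_smul]
  set R := ∑ j ∈ range n, C ((n.factorial : ℝ) / (-a) ^ n *
    (n.choose j * (-a) ^ j / j.factorial)) * (descPochhammer ℝ j).comp (X - C 1)
  have hR : R.degree < n := by
    rw [← mem_degreeLT]
    refine Submodule.sum_mem _ fun j hj => ?_
    rw [← smul_eq_C_mul]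
    refine Submodule.smul_mem _ _ (mem_degreeLT.2 ?_)
    rw [degree_eq_natDegree (hm j).ne_zero, hd]
    exact_mod_cast mem_range.1 hj
  refine ⟨(hm n).add_of_right (by rwa [hdeg]), ?_⟩
  refine natDegree_eq_of_degree_eq_some ?_
  rw [degree_add_eq_right_of_degree_lt (by rwa [hdeg]), hdeg]

lemma choose_mul_add_choose (i j x : ℕ) :
    ((x + j).choose j : ℝ) * (x + j + i).choose i =
      (i + j).choose i * (x + (i + j)).choose (i + j) := by
  have h1 := Nat.add_choose_mul_factorial_mul_factorial x j
  have h2 := Nat.add_choose_mul_factorial_mul_factorial (x + j) i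
  have h3 := Nat.add_choose_mul_factorial_mul_factorial j i
  have h4 := Nat.add_choose_mul_factorial_mul_factorial x (i + j)
  rw [add_comm j i] at h3
  rw [add_assoc, add_comm j i] at *
  norm_cast
  have hpos : 0 < x.factorial * j.factorial * i.factorial * (i + j).factorial *
      (x + j).factorial := by
    positivity
  refine Nat.eq_of_mul_eq_mul_right hpos ?_
  have l : (x + j).choose j * (x + (i + j)).choose i *
      (x.factorial * j.factorial * i.factorial * (i + j).factorial * (x + j).factorial) =
      ((x + j).choose j * x.factorial * j.factorial) *
      ((x + (i + j)).choose i * (x + j).factorial * i.factorial) * (i + j).factorial := by ring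
  have r : (i + j).choose i * (x + (i + j)).choose (i + j) *
      (x.factorial * j.factorial * i.factorial * (i + j).factorial * (x + j).factorial) =
      ((i + j).choose i * j.factorial * i.factorial) *
      ((x + (i + j)).choose (i + j) * x.factorial * (i + j).factorial) * (x + j).factorial := by
    ring
  rw [l, r, h1, h2, h3, h4]
  ring

lemma hasSum_choose_mul_choose_mul_geometric {q : ℝ} (h0 : 0 < q) (h1 : q < 1) (i j : ℕ) :
    HasSum (fun x : ℕ => (x.choose j : ℝ) * (x + i).choose i * q ^ x)
      ((i + j).choose i * q ^ j / (1 - q) ^ (i + j + 1)) := by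
  have hinj : Function.Injective fun x : ℕ => x + j := add_left_injective j
  refine (hinj.hasSum_iff fun x hx => ?_).1 ?_
  · have : x < j := by
      by_contra! hcon
      exact hx ⟨x - j, Nat.sub_add_cancel hcon⟩
    simp [Nat.choose_eq_zero_of_lt this]
  · convert! (hasSum_choose_mul_geometric_of_norm_lt_one (𝕜 := ℝ) (i + j) (r := q)
      (by rwa [Real.norm_of_nonneg h0.le])).mul_left (((i + j).choose i : ℝ) * q ^ j) using 1
    · funext x
      simp only [Function.comp_apply]
      rw [choose_mul_add_choose, pow_add]
      ring
    · ring

/-- Up to the sign `(-1) ^ k`, the sum is the `k`-th finite difference of `y ↦ C(y, i)` at `i`. -/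
lemma sum_alternating_choose_mul_choose {i k : ℕ} (hik : i ≤ k) :
    ∑ j ∈ range (k + 1), (-1 : ℝ) ^ j * k.choose j * (i + j).choose i =
      if i = k then (-1) ^ k else 0 := by
  have h1 : (fwdDiff 1)^[k] (fun x ↦ x.choose i : ℕ → ℤ) i = if i = k then 1 else 0 := by
    obtain ⟨d, rfl⟩ := Nat.exists_eq_add_of_le hik
    have hc := fwdDiff_iter_choose 0 i
    simp only [add_zero, Nat.choose_zero_right] at hc
    rw [add_comm, Function.iterate_add_apply, hc]
    rcases d with _ | d
    · simp
    · rw [fwdDiff_iter_eq_sum_shift]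
      simp only [← sum_smul]
      rw [if_neg (by omega)]
      have := Int.alternating_sum_range_choose_of_ne (n := d + 1) (by omega)
      rw [sum_congr rfl (g := fun m => (-1 : ℤ) ^ (d + 1) * ((-1) ^ m * ((d + 1).choose m : ℤ)))
        fun m hm => ?_, ← mul_sum, this]
      · simp
      · obtain ⟨c, hc⟩ := Nat.exists_eq_add_of_le (Nat.lt_succ_iff.1 (mem_range.1 hm))
        rw [hc, Nat.add_sub_cancel_left, pow_add, ← mul_assoc,
          mul_right_comm ((-1 : ℤ) ^ m), ← mul_pow]
        simp
  rw [fwdDiff_iter_eq_sum_shift] at h1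
  have h2 : ((∑ j ∈ range (k + 1), ((-1 : ℤ) ^ (k - j) * k.choose j) • ((i + j • 1).choose i : ℤ) :
      ℤ) : ℝ) = if i = k then 1 else 0 := by
    rw [h1]
    split_ifs <;> simp
  have h3 : (if i = k then (-1 : ℝ) ^ k else 0) = (-1) ^ k * if i = k then 1 else 0 := by
    split_ifs <;> simp
  rw [h3, ← h2]
  push_cast
  rw [mul_sum]
  refine sum_congr rfl fun j hj => ?_
  obtain ⟨c, hc⟩ := Nat.exists_eq_add_of_le (Nat.lt_succ_iff.1 (mem_range.1 hj))
  have : (-1 : ℝ) ^ k * (-1) ^ (k - j) = (-1) ^ j := by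
    rw [hc, Nat.add_sub_cancel_left, pow_add, mul_assoc, ← mul_pow]
    simp
  rw [← this]
  simp
  ring

lemma hasSum_meixnerValue_mul_choose {q : ℝ} (h0 : 0 < q) (h1 : q < 1) {i k : ℕ} (hik : i ≤ k) :
    HasSum (fun x : ℕ => meixnerValue ((1 - q) / q) k x * (x + i).choose i * q ^ x)
      (if i = k then (-1) ^ k / (1 - q) ^ (k + 1) else 0) := by
  have hq : 1 - q ≠ 0 := by linarith
  have hs := hasSum_sum (s := range (k + 1)) fun j _ =>
    (hasSum_choose_mul_choose_mul_geometric h0 h1 i j).mul_left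
      ((k.choose j : ℝ) * (-((1 - q) / q)) ^ j)
  convert! hs using 1
  · funext x
    rw [meixnerValue, sum_mul, sum_mul]
    exact sum_congr rfl fun j _ => by ring
  · have : ∀ j ∈ range (k + 1), (k.choose j : ℝ) * (-((1 - q) / q)) ^ j *
        ((i + j).choose i * q ^ j / (1 - q) ^ (i + j + 1)) =
        (-1 : ℝ) ^ j * k.choose j * (i + j).choose i * (1 / (1 - q) ^ (i + 1)) := fun j _ => by
      rw [neg_pow, div_pow, show i + j + 1 = i + 1 + j by ring, pow_add (1 - q) (i + 1) j]
      field_simp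
    rw [sum_congr rfl this, ← sum_mul, sum_alternating_choose_mul_choose hik]
    split_ifs with h
    · rw [h]; ring
    · ring

lemma isMonicOrthogonal_meixnerPoly {q : ℝ} (h0 : 0 < q) (h1 : q < 1) :
    IsMonicOrthogonal (fun l => q ^ l) (meixnerPoly ((1 - q) / q)) (meixnerNorm q) := by
  have hq : 1 - q ≠ 0 := by linarith
  have ha : (1 - q) / q ≠ 0 := div_ne_zero hq h0.ne'
  have hmd := meixnerPoly_monic_natDegree ha
  have hv := hasMoments_geometric h0.le h1
  -- pairing with the rising factorials `l (l + 1) ⋯ (l + i - 1)`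
  have key : ∀ i k : ℕ, i ≤ k → momentFunctional _ hv
      (meixnerPoly ((1 - q) / q) k * ascPochhammer ℝ i) = if i = k then meixnerNorm q k else 0 := by
    intro i k hik
    refine (hasSum_momentFunctional hv _).unique ?_
    convert! (hasSum_meixnerValue_mul_choose h0 h1 hik).mul_left
      ((k.factorial : ℝ) / (-((1 - q) / q)) ^ k * i.factorial * q) using 1
    · funext x
      rw [eval_mul, meixnerPoly_eval, ascPochhammer_nat_eq_natCast_ascFactorial,
        Nat.ascFactorial_eq_factorial_mul_choose, Nat.cast_mul, pow_succ]
      ring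
    · split_ifs with h
      · have hs : ((-1 : ℝ) ^ k) ≠ 0 := pow_ne_zero _ (by norm_num)
        rw [h, meixnerNorm, neg_pow, div_pow, show 2 * k + 1 = k + (k + 1) by ring, pow_add (1 - q)]
        field_simp
        ring
      · ring
  have hortho : ∀ k : ℕ, ∀ p : ℝ[X], p.degree < k →
      momentFunctional _ hv (meixnerPoly ((1 - q) / q) k * p) = 0 := fun k =>
    linearMap_eq_zero_of_degree_lt
      (momentFunctional _ hv ∘ₗ LinearMap.mulLeft ℝ (meixnerPoly ((1 - q) / q) k))
      (fun i => monic_ascPochhammer ℝ i) (fun i => ascPochhammer_natDegree (S := ℝ) i) k fun i hi =>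
        (key i k hi.le).trans (if_neg hi.ne)
  refine isMonicOrthogonal_of_degree_lt hv (fun k => (hmd k).1) (fun k => (hmd k).2) hortho
    fun k => ?_
  have := linearMap_eq_of_monic
    (momentFunctional _ hv ∘ₗ LinearMap.mulLeft ℝ (meixnerPoly ((1 - q) / q) k)) (hortho k)
    (hmd k).1 (hmd k).2 (monic_ascPochhammer ℝ k) (ascPochhammer_natDegree (S := ℝ) k)
  simpa using this.trans (key k k le_rfl)

/-! ### Decay of Meixner polynomials against a smaller geometric weight -/

lemma abs_meixnerValue_le {a b : ℝ} (ha : 0 < a) (hb : 0 < b) (n x : ℕ) :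
    |meixnerValue a n x| ≤ (1 + b) ^ n * (1 + a / b) ^ x := by
  have hterm : ∀ j : ℕ, (x.choose j : ℝ) * (a / b) ^ j ≤ (1 + a / b) ^ x := fun j => by
    have hab : 0 ≤ a / b := by positivity
    rcases le_or_gt j x with hj | hj
    · rw [add_comm, add_pow]
      refine le_trans (le_of_eq ?_) (single_le_sum (f := fun m => (a / b) ^ m * 1 ^ (x - m) *
        (x.choose m : ℝ)) (fun m _ => by positivity) (mem_range.2 (Nat.lt_succ_of_le hj)))
      simp [mul_comm]
    · rw [Nat.choose_eq_zero_of_lt hj]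
      simp only [Nat.cast_zero, zero_mul]
      positivity
  rw [add_comm 1 b, add_pow, sum_mul]
  refine (abs_sum_le_sum_abs _ _).trans (sum_le_sum fun j _ => ?_)
  have h1 : |(n.choose j : ℝ) * x.choose j * (-a) ^ j| =
      (b ^ j * n.choose j) * (x.choose j * (a / b) ^ j) := by
    rw [abs_mul, abs_pow, abs_neg, abs_of_pos ha, abs_of_nonneg (by positivity), div_pow]
    field_simp
  rw [h1, one_pow, mul_one]
  exact mul_le_mul_of_nonneg_left (hterm j) (by positivity)

/-- By self-duality the orthogonality relation in the degree bounds each value of a Meixner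
polynomial: `q ^ n M_x(n)²` is one term of the series `∑_n q ^ n M_x(n)² = q ^ (-x) / (1 - q)`. -/
lemma pow_mul_meixnerValue_sq_le {q : ℝ} (h0 : 0 < q) (h1 : q < 1) (n x : ℕ) :
    q ^ n * meixnerValue ((1 - q) / q) n x ^ 2 ≤ (1 / q) ^ x / (1 - q) := by
  have hq : 0 < 1 - q := by linarith
  rw [meixnerValue_comm]
  have hs := (isMonicOrthogonal_meixnerPoly h0 h1).orthogonal x x
  rw [if_pos rfl] at hs
  have := le_hasSum hs n fun i _ => mul_nonneg (mul_self_nonneg _) (by positivity)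
  simp only [meixnerPoly_eval] at this
  have hc : (x.factorial / (-((1 - q) / q)) ^ x) ^ 2 =
      (x.factorial : ℝ) ^ 2 * q ^ (2 * x) / (1 - q) ^ (2 * x) := by
    rw [div_pow, ← pow_mul, mul_comm x 2, (even_two_mul x).neg_pow, div_pow, div_div_eq_mul_div]
  have hpos : 0 < (x.factorial : ℝ) ^ 2 * q ^ (2 * x) / (1 - q) ^ (2 * x) * q := by positivity
  refine le_of_mul_le_mul_left ?_ hpos
  calc _ = (x.factorial / (-((1 - q) / q)) ^ x * meixnerValue ((1 - q) / q) x n) *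
        (x.factorial / (-((1 - q) / q)) ^ x * meixnerValue ((1 - q) / q) x n) * q ^ (n + 1) := by
        rw [← hc]; ring
    _ ≤ _ := this
    _ = _ := by
        rw [meixnerNorm, one_div, inv_pow]
        field_simp
        ring

/-- Interpolation: a quantity bounded both by `C ρ ^ x` and by `κ ^ n K ^ x`, with `ρ, κ < 1` and `K`
arbitrary, decays geometrically in `n` and `x` jointly. -/
lemma exists_joint_geometric_bound {A ρ κ K : ℝ} (hA : 0 < A) (hρ0 : 0 < ρ) (hρ1 : ρ < 1)
    (hκ0 : 0 < κ) (hκ1 : κ < 1) (hK : 0 < K) :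
    ∃ D σ θ : ℝ, 0 < D ∧ 0 < σ ∧ σ < 1 ∧ 0 < θ ∧ θ < 1 ∧ ∀ (n x : ℕ) (T : ℝ), 0 ≤ T →
      T ≤ A * ρ ^ x → T ≤ κ ^ n * K ^ x → T ≤ D * (σ ^ n * θ ^ x) := by
  obtain ⟨τ, hτ0, hτ1, hτ⟩ : ∃ τ : ℝ, 0 < τ ∧ τ < 1 ∧ ρ ^ (1 - τ) * K ^ τ < 1 := by
    have hcont : Continuous fun τ : ℝ => ρ ^ (1 - τ) * K ^ τ :=
      (continuous_const.rpow (continuous_const.sub continuous_id) fun _ => Or.inl hρ0.ne').mul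
        (continuous_const.rpow continuous_id fun _ => Or.inl hK.ne')
    have hev : ∀ᶠ τ in nhds (0 : ℝ), ρ ^ (1 - τ) * K ^ τ < 1 :=
      hcont.continuousAt.eventually_lt_const (by simpa using hρ1)
    have hev' := (hev.filter_mono nhdsWithin_le_nhds).and
      (Ioo_mem_nhdsGT (show (0 : ℝ) < 1 by norm_num))
    obtain ⟨τ, h1, h2⟩ := hev'.exists
    exact ⟨τ, h2.1, h2.2, h1⟩
  refine ⟨A ^ (1 - τ), κ ^ τ, ρ ^ (1 - τ) * K ^ τ, by positivity, by positivity,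
    Real.rpow_lt_one hκ0.le hκ1 hτ0, by positivity, hτ, fun n x T hT h1 h2 => ?_⟩
  have hpow : ∀ {y : ℝ}, 0 < y → ∀ (s : ℝ) (m : ℕ), (y ^ m) ^ s = (y ^ s) ^ m := fun hy s m => by
    rw [← Real.rpow_natCast, ← Real.rpow_natCast, ← Real.rpow_mul hy.le, ← Real.rpow_mul hy.le,
      mul_comm]
  calc T = T ^ (1 - τ) * T ^ τ := by
        rw [← Real.rpow_add_of_nonneg hT (by linarith) hτ0.le, sub_add_cancel, Real.rpow_one]
    _ ≤ (A * ρ ^ x) ^ (1 - τ) * (κ ^ n * K ^ x) ^ τ := by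
        refine mul_le_mul (Real.rpow_le_rpow hT h1 (by linarith)) (Real.rpow_le_rpow hT h2 hτ0.le)
          (by positivity) (by positivity)
    _ = _ := by
        rw [Real.mul_rpow hA.le (by positivity), Real.mul_rpow (by positivity) (by positivity),
          hpow hρ0, hpow hκ0, hpow hK, mul_pow]
        ring

/-- The norm of the `n`-th Meixner polynomial for the smaller weight `r ^ l`, relative to its norm
for `q ^ l`, decays geometrically in `n`. -/
lemma exists_momentFunctional_meixnerPoly_le {q r : ℝ} (hr0 : 0 < r) (hrq : r < q) (hq1 : q < 1)
    (he : HasMoments fun l => r ^ l) :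
    ∃ B σ : ℝ, 0 < B ∧ 0 < σ ∧ σ < 1 ∧ ∀ n : ℕ,
      momentFunctional _ he (meixnerPoly ((1 - q) / q) n * meixnerPoly ((1 - q) / q) n) ≤
        B * σ ^ n * meixnerNorm q n := by
  have h0 : 0 < q := hr0.trans hrq
  have hq : 0 < 1 - q := by linarith
  have ha : 0 < (1 - q) / q := by positivity
  -- `b` is so small that `q (1 + b)² < 1`
  set b := (1 - q) / 4 with hb
  have hb0 : 0 < b := by positivity
  have hκ : q * (1 + b) ^ 2 < 1 := by
    have : q = 1 - 4 * b := by rw [hb]; ring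
    rw [this]
    nlinarith [pow_pos hb0 3, pow_pos hb0 2]
  obtain ⟨D, σ, θ, hD, hσ0, hσ1, hθ0, hθ1, hbound⟩ :=
    exists_joint_geometric_bound (A := 1 / (1 - q)) (ρ := r / q) (κ := q * (1 + b) ^ 2)
      (K := r * (1 + (1 - q) / q / b) ^ 2) (by positivity) (by positivity)
      ((div_lt_one h0).2 hrq) (by positivity) hκ (by positivity)
  have hT : ∀ n x : ℕ, q ^ n * meixnerValue ((1 - q) / q) n x ^ 2 * r ^ x ≤
      D * (σ ^ n * θ ^ x) := by
    intro n x
    refine hbound n x _ (by positivity) ?_ ?_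
    · refine (mul_le_mul_of_nonneg_right (pow_mul_meixnerValue_sq_le h0 hq1 n x)
        (by positivity)).trans (le_of_eq ?_)
      rw [div_pow, div_pow, one_pow]
      field_simp
    · have h1 : meixnerValue ((1 - q) / q) n x ^ 2 ≤
          ((1 + b) ^ n * (1 + (1 - q) / q / b) ^ x) ^ 2 := by
        rw [← sq_abs]
        exact pow_le_pow_left₀ (abs_nonneg _) (abs_meixnerValue_le ha hb0 n x) 2
      calc _ ≤ q ^ n * ((1 + b) ^ n * (1 + (1 - q) / q / b) ^ x) ^ 2 * r ^ x := by gcongr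
        _ = _ := by rw [mul_pow q, mul_pow r, ← pow_mul, ← pow_mul]; ring
  refine ⟨(1 - q) / q * r * D * (1 - θ)⁻¹, σ, ?_, hσ0, hσ1, fun n => ?_⟩
  · have : 0 < 1 - θ := by linarith
    positivity
  set N := meixnerNorm q n with hN
  have hN0 : 0 < N := by rw [hN, meixnerNorm]; positivity
  refine (hasSum_le (fun x => ?_) (hasSum_momentFunctional he _)
    ((hasSum_geometric_of_lt_one hθ0.le hθ1).mul_left
      ((1 - q) / q * r * D * σ ^ n * N))).trans_eq (by ring)
  have hc : (n.factorial / (-((1 - q) / q)) ^ n) ^ 2 = (1 - q) / q * N * q ^ n := by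
    rw [hN, meixnerNorm, div_pow, ← pow_mul, mul_comm n 2, (even_two_mul n).neg_pow, div_pow,
      div_div_eq_mul_div]
    field_simp
    ring
  calc _ = (n.factorial / (-((1 - q) / q)) ^ n) ^ 2 * meixnerValue ((1 - q) / q) n x ^ 2 *
        r ^ (x + 1) := by rw [eval_mul, meixnerPoly_eval]; ring
    _ = (1 - q) / q * N * r * (q ^ n * meixnerValue ((1 - q) / q) n x ^ 2 * r ^ x) := by
        rw [hc]; ring
    _ ≤ (1 - q) / q * N * r * (D * (σ ^ n * θ ^ x)) := by
        have := hT n x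
        gcongr
    _ = _ := by ring

/-! ### Relative errors -/

/-- Geometric decay is faster than `e^{-k^{1-ε}}`. -/
lemma isBigO_geometric_exp_neg_rpow {σ ε : ℝ} (hσ0 : 0 < σ) (hσ1 : σ < 1) (hε : 0 < ε) :
    Asymptotics.IsBigO Filter.atTop (fun k : ℕ => σ ^ k)
      (fun k : ℕ => Real.exp (-((k : ℝ) ^ (1 - ε)))) := by
  refine Asymptotics.IsBigO.of_bound 1 ?_
  have hlog : 0 < -Real.log σ := neg_pos.2 (Real.log_neg hσ0 hσ1)
  have ht : Filter.Tendsto (fun k : ℕ => (k : ℝ) ^ (-ε)) Filter.atTop (nhds 0) :=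
    (tendsto_rpow_neg_atTop hε).comp tendsto_natCast_atTop_atTop
  filter_upwards [ht.eventually_lt_const hlog, Filter.eventually_gt_atTop 0] with k hk hk0
  have hk0' : (0 : ℝ) < k := by exact_mod_cast hk0
  rw [one_mul, Real.norm_of_nonneg (by positivity), Real.norm_of_nonneg (Real.exp_pos _).le,
    ← Real.exp_log (pow_pos hσ0 k), Real.exp_le_exp, Real.log_pow,
    show (1 : ℝ) - ε = 1 + -ε by ring, Real.rpow_add hk0', Real.rpow_one]
  nlinarith

/-- Sequences with geometrically small relative distance from `g` agree up to the stated relative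
errors, with `g` and with each other. -/
lemma eqUpToRelError_of_abs_sub_le {g a b : ℕ → ℝ} {B σ ε : ℝ} (hσ0 : 0 < σ)
    (hσ1 : σ < 1) (hε : 0 < ε) (hg : ∀ k, 0 < g k) (hb : ∀ k, 0 < b k)
    (hag : ∀ k, |a k - g k| ≤ B * σ ^ k * g k) (hbg : ∀ k, |b k - g k| ≤ B * σ ^ k * g k) :
    EqUpToRelError ε a b := by
  refine ⟨fun k => a k / b k - 1, ?_, fun k => ?_⟩
  · refine Asymptotics.IsBigO.trans ?_ (isBigO_geometric_exp_neg_rpow hσ0 hσ1 hε)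
    refine Asymptotics.IsBigO.of_bound (4 * B) ?_
    have ht : Filter.Tendsto (fun k : ℕ => B * σ ^ k) Filter.atTop (nhds 0) := by
      simpa using (tendsto_pow_atTop_nhds_zero_of_lt_one hσ0.le hσ1).const_mul B
    filter_upwards [ht.eventually_lt_const (show (0 : ℝ) < 1 / 2 by norm_num)] with k hk
    have h1 := abs_le.1 (hag k)
    have h2 := abs_le.1 (hbg k)
    have hgb : g k ≤ 2 * b k := by nlinarith [hg k]
    have hB : 0 ≤ B * σ ^ k := by
      by_contra! hcon
      nlinarith [hg k, abs_nonneg (a k - g k), hag k]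
    rw [div_sub_one (hb k).ne', Real.norm_eq_abs, abs_div, abs_of_pos (hb k), div_le_iff₀ (hb k),
      Real.norm_of_nonneg (by positivity)]
    have h3 : |a k - b k| ≤ 2 * (B * σ ^ k) * g k := by
      rw [abs_le]
      constructor <;> linarith
    nlinarith [mul_le_mul_of_nonneg_left hgb hB]
  · have := (hb k).ne'
    field_simp
    ring

theorem mainTheorem6 (t γ q s : ℝ) (hγ : 0 < γ) (hγt : γ < t)
    (hq : q = Real.exp (-2 * (t - γ)))
    (hs : s = 2 * γ ∨ s = 0) :
    (∃ P : ℕ → Polynomial ℝ, IsMonicOrthogonal (fun l => q ^ l) P (meixnerNorm q)) ∧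
    (∃ (P : ℕ → Polynomial ℝ) (h : ℕ → ℝ), IsMonicOrthogonal (weightDW t γ) P h) ∧
    (∃ (P : ℕ → Polynomial ℝ) (h : ℕ → ℝ), IsMonicOrthogonal (weightHT t γ s) P h) ∧
    ∀ (PDW PHT : ℕ → Polynomial ℝ) (hDW hHT : ℕ → ℝ),
      IsMonicOrthogonal (weightDW t γ) PDW hDW →
      IsMonicOrthogonal (weightHT t γ s) PHT hHT →
      ∀ ε : ℝ, 0 < ε →
        EqUpToRelError ε hDW hHT ∧
        EqUpToRelError ε hDW (meixnerNorm q) ∧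
        EqUpToRelError ε hHT (meixnerNorm q) := by
  set r := Real.exp (-2 * (t + γ)) with hr
  have hr0 : 0 < r := Real.exp_pos _
  have hrq : r < q := by
    rw [hq, hr, Real.exp_lt_exp]
    linarith
  have hq0 : 0 < q := hr0.trans hrq
  have hq1 : q < 1 := by
    rw [hq, Real.exp_lt_one_iff]
    linarith
  have hc0 : 0 < Real.exp (-s) := Real.exp_pos _
  have hc1 : Real.exp (-s) ≤ 1 := by
    rw [Real.exp_le_one_iff]
    rcases hs with rfl | rfl <;> linarith
  generalize hc : Real.exp (-s) = c at hc0 hc1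
  have hqpow : ∀ l : ℕ, Real.exp (-2 * (l : ℝ) * (t - γ)) = q ^ l := fun l => by
    rw [hq, ← Real.exp_nat_mul]
    ring_nf
  have hrpow : ∀ l : ℕ, Real.exp (-2 * (l : ℝ) * (t + γ)) = r ^ l := fun l => by
    rw [hr, ← Real.exp_nat_mul]
    ring_nf
  have hDWe : weightDW t γ = fun l => q ^ l + -1 * r ^ l := by
    funext l
    rw [weightDW, hqpow, hrpow]
    ring
  have hHTe : weightHT t γ s = fun l => q ^ l + c * r ^ l := by
    funext l
    rw [weightHT, sub_eq_add_neg (-2 * (l : ℝ) * (t + γ)) s, Real.exp_add, hqpow, hrpow, hc]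
    ring
  rw [hDWe, hHTe]
  have hv := hasMoments_geometric hq0.le hq1
  have he := hasMoments_geometric hr0.le (hrq.trans hq1)
  have hDW := hv.add (he.const_mul (-1))
  have hHT := hv.add (he.const_mul c)
  have hDWpos : ∀ l : ℕ, 1 ≤ l → 0 < q ^ l + -1 * r ^ l := fun l hl => by
    have := pow_lt_pow_left₀ hrq hr0.le (show l ≠ 0 by omega)
    linarith
  have hHTpos : ∀ l : ℕ, 1 ≤ l → 0 < q ^ l + c * r ^ l := fun l _ => by positivity
  have hM := isMonicOrthogonal_meixnerPoly hq0 hq1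
  refine ⟨⟨_, hM⟩, exists_isMonicOrthogonal hDW hDWpos, exists_isMonicOrthogonal hHT hHTpos, ?_⟩
  intro PDW PHT hD hH HD HH ε hε
  -- `C = 1 / (1 - r / q)` is the supremum of `q ^ l / (q ^ l - r ^ l)` over `l ≥ 1`
  set C := q / (q - r) with hC
  have hqr : 0 < q - r := sub_pos.2 hrq
  have hC1 : 1 ≤ C := by
    rw [hC, le_div_iff₀ hqr]
    linarith
  have hCr : ∀ l : ℕ, 1 ≤ l → C * r ^ l ≤ (C - 1) * q ^ l := fun l hl => by
    obtain ⟨m, rfl⟩ : ∃ m, l = m + 1 := ⟨l - 1, by omega⟩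
    have h1 : C - 1 = r / (q - r) := by
      rw [hC]
      field_simp
      ring
    have h2 : r ^ m ≤ q ^ m := pow_le_pow_left₀ hr0.le hrq.le m
    rw [h1, hC, div_mul_eq_mul_div, div_mul_eq_mul_div]
    refine div_le_div_of_nonneg_right ?_ hqr.le
    rw [pow_succ, pow_succ]
    nlinarith [mul_le_mul_of_nonneg_left h2 (mul_pos hq0 hr0).le]
  obtain ⟨B, σ, hB, hσ0, hσ1, hbound⟩ := exists_momentFunctional_meixnerPoly_le hr0 hrq hq1 he
  have hg : ∀ k, 0 < meixnerNorm q k :=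
    hM.norm_pos hv fun l _ => pow_pos hq0 l
  have hscale : ∀ (h : ℕ → ℝ) (k : ℕ), |h k - meixnerNorm q k| ≤ C * momentFunctional _ he
      (meixnerPoly ((1 - q) / q) k * meixnerPoly ((1 - q) / q) k) →
      |h k - meixnerNorm q k| ≤ C * B * σ ^ k * meixnerNorm q k := fun h k hk =>
    hk.trans ((mul_le_mul_of_nonneg_left (hbound k) (by linarith)).trans_eq (by ring))
  have hDg : ∀ k, |hD k - meixnerNorm q k| ≤ C * B * σ ^ k * meixnerNorm q k := fun k => by
    refine hscale hD k (HD.abs_norm_sub_le hv hDW he (fun l _ => pow_pos hq0 l) hDWpos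
      (fun l _ => pow_pos hr0 l) (by linarith) (fun l _ => ?_) (fun l hl => ?_) hM k)
    · nlinarith [pow_pos hr0 l]
    · nlinarith [mul_le_mul_of_nonneg_left (hCr l hl) (pow_pos hr0 l).le]
  have hHg : ∀ k, |hH k - meixnerNorm q k| ≤ C * B * σ ^ k * meixnerNorm q k := fun k => by
    refine hscale hH k (HH.abs_norm_sub_le hv hHT he (fun l _ => pow_pos hq0 l) hHTpos
      (fun l _ => pow_pos hr0 l) (by linarith) (fun l _ => ?_) (fun l _ => ?_) hM k)
    · have := pow_pos hr0 l
      gcongr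
      linarith
    · have h1 : 0 ≤ q ^ l * (C * r ^ l) := by positivity
      have h2 : 0 ≤ c * r ^ l * (q ^ l + C * r ^ l) := by positivity
      nlinarith
  have hgg : ∀ k, |meixnerNorm q k - meixnerNorm q k| ≤ C * B * σ ^ k * meixnerNorm q k :=
    fun k => by
      have := hg k
      rw [sub_self, abs_zero]
      positivity
  exact ⟨eqUpToRelError_of_abs_sub_le hσ0 hσ1 hε hg (HH.norm_pos hHT hHTpos) hDg hHg,
    eqUpToRelError_of_abs_sub_le hσ0 hσ1 hε hg hg hDg hgg,
    eqUpToRelError_of_abs_sub_le hσ0 hσ1 hε hg hg hHg hgg⟩
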